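/- Let $T>0$, let $F:\mathbb{R}^N\times\mathbb{R}^m\to\mathbb{R}$ and $\mathbf{f}:\mathbb{R}^N\times\mathbb{R}^m\to\mathbb{R}^N$ be of class $C^1$, and consider the optimal feedback control problem without control constraints: minimize $\int_t^T F(\mathbf{x}(s),\mathbf{u}(s,\mathbf{x}(s)))\,ds$ subject to $\mathbf{x}'(s)=\mathbf{f}(\mathbf{x}(s),\mathbf{u}(s,\mathbf{x}(s)))$ in $(t,T)$, $\mathbf{x}(t)=\mathbf{y}$. Let $\mathbf{u}\in L^\infty(0,T;W^{1,\infty}(\mathbb{R}^N;\mathbb{R}^m))$ be a feasible map, and let $\mathbf{p}:[0,T]\times\mathbb{R}^N\to\mathbb{R}^N$ be a costate of $\mathbf{u}$, that is, a weak solution (locally integrable in $(t,\mathbf{x})$ and in $\mathbf{x}$ for every $t\in[0,T]$, and weakly continuous in time on $[0,T]$) of the linear transport system $$\mathbf{p}_t+\nabla\mathbf{p}\,\mathbf{f}(\mathbf{x},\mathbf{u}(t,\mathbf{x}))+\mathbf{p}\,\nabla_{\mathbf{x}}[\mathbf{f}(\mathbf{x},\mathbf{u}(t,\mathbf{x}))]=\nabla_{\mathbf{x}}[F(\mathbf{x},\mathbf{u}(t,\mathbf{x}))]\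 \hbox{ in }(0,T)\times\mathbb{R}^N,\qquad \mathbf{p}(T,\mathbf{x})=0 \hbox{ for a.e. }\mathbf{x}.$$ Put $$\nabla I(\mathbf{u})(t,\mathbf{x})=F_{\mathbf{u}}(\mathbf{x},\mathbf{u}(t,\mathbf{x}))-\mathbf{p}(t,\mathbf{x})\,\mathbf{f}_{\mathbf{u}}(\mathbf{x},\mathbf{u}(t,\mathbf{x})).$$ Let $D^{1,2}(\mathbb{R}^N;\mathbb{R}^m)$ denote the set of $W\in L^1_{loc}$ with weak gradient $\nabla W\in L^2$ for which there are $\varphi_n\in C_c^\infty(\mathbb{R}^N;\mathbb{R}^m)$ with $\varphi_n\to W$ in $L^1_{loc}$ and $\nabla\varphi_n\to\nabla W$ in $L^2$. Let $t\in[0,T]$, and let $\mathbf{U}(t,\cdot)\in D^{1,2}(\mathbb{R}^N;\mathbb{R}^m)$ be a finite-energy weak solution of $$-\Delta\mathbf{U}(t,\mathbf{x})+\nabla I(\mathbf{u})(t,\mathbf{x})=0\quad\hbox{in }\mathbb{R}^N,$$ i.e. $\nabla I(\mathbf{u})(t,\cdot)\in L^1_{loc}$ and $\int\nabla\mathbf{U}(t,\cdot):\nabla\psi\,d\mathbf{x}+\int\nabla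 I(\mathbf{u})(t,\cdot)\cdot\psi\,d\mathbf{x}=0$ for all $\psi\in C_c^\infty(\mathbb{R}^N;\mathbb{R}^m)$. Assume that $\nabla I(\mathbf{u})(t,\cdot)\cdot\mathbf{U}(t,\cdot)$ is integrable on $\mathbb{R}^N$. Then $\mathbf{U}(t,\cdot)$ is a descent direction at $\mathbf{u}$ in the average sense $$\int_{\mathbb{R}^N}\nabla I(\mathbf{u})(t,\mathbf{x})\cdot\mathbf{U}(t,\mathbf{x})\,d\mathbf{x}=-\int_{\mathbb{R}^N}|\nabla\mathbf{U}(t,\mathbf{x})|^2\,d\mathbf{x}\le0 .$$ In particular, if this holds for every $t\in[0,T]$, so does the conclusion. -/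

import Mathlib

open MeasureTheory Set Filter Topology
open scoped ContDiff

noncomputable section

namespace FeedbackControl

/-- `ℝᵈ` with its Euclidean norm. -/
abbrev Eucl (d : ℕ) : Type := EuclideanSpace ℝ (Fin d)

/-- `g` is smooth with compact support. -/
def IsTest {X Y : Type*} [NormedAddCommGroup X] [NormedSpace ℝ X]
    [NormedAddCommGroup Y] [NormedSpace ℝ Y] (g : X → Y) : Prop :=
  ContDiff ℝ ∞ g ∧ HasCompactSupport g

/-- The classical partial derivative `∂ⱼ g (x)`. -/
def pderiv {N : ℕ} {Y : Type*} [NormedAddCommGroup Y] [NormedSpace ℝ Y]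
    (j : Fin N) (g : Eucl N → Y) (x : Eucl N) : Y :=
  fderiv ℝ g x (EuclideanSpace.single j 1)

/-- The divergence of a vector field on `ℝᴺ`. -/
def divergence {N : ℕ} (b : Eucl N → Eucl N) (x : Eucl N) : ℝ :=
  ∑ i : Fin N, (pderiv i b x) i

/-- Feasible feedback maps without control constraints: `u ∈ L^∞(0,T; W^{1,∞}(ℝᴺ; ℝᵐ))`, where
`W^{1,∞}(ℝᴺ)` is the space of bounded Lipschitz functions. -/
structure IsFeasible {N m : ℕ} (T : ℝ) (u : ℝ → Eucl N → Eucl m) : Prop where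
  aestronglyMeasurable : AEStronglyMeasurable (fun z : ℝ × Eucl N => u z.1 z.2)
    (volume.restrict (Ioo 0 T ×ˢ univ))
  bounded : ∃ C : NNReal, ∀ᵐ t ∂(volume.restrict (Ioo 0 T)),
    (∀ x, ‖u t x‖ ≤ C) ∧ LipschitzWith C (u t)

/-- The closed-loop field `x ↦ f (x, u (t, x))`. -/
def closedLoop {N m : ℕ} {Y : Type*} (f : Eucl N → Eucl m → Y) (u : ℝ → Eucl N → Eucl m)
    (t : ℝ) : Eucl N → Y :=
  fun x => f x (u t x)

/-- `p` is a (weak) solution on `[0,T] × ℝᴺ` of the linear transport system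
`p_t + ∇p f(x,u(t,x)) + p ∇ₓ[f(x,u(t,x))] = ∇ₓ[F(x,u(t,x))]`, `p(T,·) = 0`.
With `b(t,x) = f(x,u(t,x))`, testing with `φ` and integrating the first two terms by parts gives
`-p·φ_t - p·(∇φ b) - (div b) p·φ` for them; `b(t,·)` is locally Lipschitz, so that its derivative
exists almost everywhere. The weak continuity in time gives a meaning to each `p(t,·)`. -/
structure IsCostate {N m : ℕ} (T : ℝ) (F : Eucl N → Eucl m → ℝ)
    (f : Eucl N → Eucl m → Eucl N) (u : ℝ → Eucl N → Eucl m) (p : ℝ → Eucl N → Eucl N) :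
    Prop where
  locallyIntegrable : LocallyIntegrableOn (fun z : ℝ × Eucl N => p z.1 z.2) (Icc 0 T ×ˢ univ)
  locallyIntegrable_slice : ∀ t ∈ Icc 0 T, LocallyIntegrable (p t)
  weaklyContinuous : ∀ ψ : Eucl N → Eucl N, IsTest ψ →
    ContinuousOn (fun t => ∫ x, inner ℝ (p t x) (ψ x)) (Icc 0 T)
  terminal : ∀ᵐ x, p T x = 0
  transport : ∀ φ : ℝ × Eucl N → Eucl N, IsTest φ → tsupport φ ⊆ Ioo 0 T ×ˢ univ →
    ∫ z in Ioo 0 T ×ˢ univ,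
        (- inner ℝ (p z.1 z.2) (fderiv ℝ φ z (1, 0))
          - inner ℝ (p z.1 z.2) (fderiv ℝ φ z (0, closedLoop f u z.1 z.2))
          - divergence (closedLoop f u z.1) z.2 * inner ℝ (p z.1 z.2) (φ z)
          + inner ℝ (p z.1 z.2) (fderiv ℝ (closedLoop f u z.1) z.2 (φ z)))
      = ∫ z in Ioo 0 T ×ˢ univ, fderiv ℝ (closedLoop F u z.1) z.2 (φ z)

/-- `∇I(u)(t,x) = F_u(x,u(t,x)) - p(t,x) f_u(x,u(t,x))`, as a vector of `ℝᵐ`. -/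
def gradI {N m : ℕ} (F : Eucl N → Eucl m → ℝ) (f : Eucl N → Eucl m → Eucl N)
    (u : ℝ → Eucl N → Eucl m) (p : ℝ → Eucl N → Eucl N) (t : ℝ) (x : Eucl N) : Eucl m :=
  gradient (F x) (u t x) - ContinuousLinearMap.adjoint (fderiv ℝ (f x) (u t x)) (p t x)

/-- `V j` is the weak partial derivative `∂ⱼ W`, for every `j`. -/
def HasWeakGradient {N m : ℕ} (W : Eucl N → Eucl m) (V : Fin N → Eucl N → Eucl m) : Prop :=
  LocallyIntegrable W ∧ ∀ j, LocallyIntegrable (V j) ∧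
    ∀ ψ : Eucl N → ℝ, IsTest ψ → ∫ x, pderiv j ψ x • W x = - ∫ x, ψ x • V j x

/-- `W`, with weak gradient `V`, belongs to the Dirichlet energy space `D^{1,2}(ℝᴺ; ℝᵐ)`: the
gradient is square integrable and `W` is a limit of test functions, in `L¹_loc` for the functions
and in `L²` for the gradients. -/
structure InEnergySpace {N m : ℕ} (W : Eucl N → Eucl m) (V : Fin N → Eucl N → Eucl m) : Prop where
  weakGradient : HasWeakGradient W V
  memLp : ∀ j, MemLp (V j) 2
  approx : ∃ φ : ℕ → Eucl N → Eucl m, (∀ n, IsTest (φ n)) ∧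
    (∀ K : Set (Eucl N), IsCompact K →
      Tendsto (fun n => ∫ x in K, ‖φ n x - W x‖) atTop (𝓝 0)) ∧
    ∀ j, Tendsto (fun n => eLpNorm (fun x => pderiv j (φ n) x - V j x) 2 volume) atTop (𝓝 0)

/-- `W`, with weak gradient `V`, is a finite-energy weak solution of `-ΔW + G = 0` in `ℝᴺ`. -/
structure SolvesPoisson {N m : ℕ} (G : Eucl N → Eucl m) (W : Eucl N → Eucl m)
    (V : Fin N → Eucl N → Eucl m) : Prop where
  locallyIntegrable : LocallyIntegrable G
  energy : InEnergySpace W V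
  weak : ∀ ψ : Eucl N → Eucl m, IsTest ψ →
    (∫ x, ∑ j, inner ℝ (V j x) (pderiv j ψ x)) + ∫ x, inner ℝ (G x) (ψ x) = 0

end FeedbackControl

end

/-!
The claim is the energy identity for `-ΔU + G = 0` with `G = ∇I(u)(t, ·)`. Formally one tests the
equation with `U`, but `G` is only locally integrable and `U` is not a test function, so that
neither side passes to the limit along arbitrary approximations of `U`. As in the theorem of
Brezis and Browder on the action of `H⁻¹ ∩ L¹_loc` on `H¹`, the approximations are truncated in
such a way that the limit is a multiple of `U` by a bounded function.

Let `φ n` be test functions converging to `U` in the energy space and, after passing to a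
subsequence, almost everywhere. The functions `ψ = damp ε (φ k) (φ n)`, where `damp ε a b = 2|b|²
/ (ε² + |a|² + |b|²) • a`, are again test functions, since `damp` is smooth and vanishes at `b =
0`. They are bounded by `|φ n|`, so `∫ G · ψ` converges to `∫ G · damp ε U (φ n)` as `k → ∞`; this
in turn converges to `∫ G · U` as `n → ∞` and `ε → 0`, with majorant `2 |G · U|`. On the side of
the gradients, `damp ε` is Lipschitz uniformly in `ε` (`norm_fderiv_damp_le`), so `∇ψ` stays
bounded in `L²`, while `ψ → U` in `L¹_loc` (`tendsto_damp_locally_L1`). Hence `∇ψ` converges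
weakly to `∇U` in `L²`, which is enough for `∫ ∇U : ∇ψ → ∫ |∇U|²`
(`tendsto_integral_inner_pderiv`). Weak convergence makes it unnecessary to know the limit of the
derivative of `damp` on the set `U = 0`.
-/

namespace FeedbackControl

/-! ### Smooth truncation -/

section

variable {E : Type*} [NormedAddCommGroup E] [InnerProductSpace ℝ E]

/-- The factor `2|b|² / (ε² + |a|² + |b|²)`, with values in `[0, 2]`. The term `ε²` keeps it smooth at
the origin. -/
noncomputable def dampWeight (ε : ℝ) (a b : E) : ℝ := 2 * ‖b‖ ^ 2 / (ε ^ 2 + ‖a‖ ^ 2 + ‖b‖ ^ 2)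

/-- The vector `a` multiplied by `dampWeight ε a b`. It is a smooth, homogeneous (jointly in
`(ε, a, b)`) substitute for the radial truncation of `a` to length `|b|`: it is a nonnegative multiple
of `a`, no longer than `b`, and it is close to `c` when `a` and `b` are. -/
noncomputable def damp (ε : ℝ) (a b : E) : E := dampWeight ε a b • a

omit [InnerProductSpace ℝ E] in
lemma dampWeight_nonneg (ε : ℝ) (a b : E) : 0 ≤ dampWeight ε a b := by
  unfold dampWeight; positivity

omit [InnerProductSpace ℝ E] in
lemma dampWeight_le_two (ε : ℝ) (a b : E) : dampWeight ε a b ≤ 2 := by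
  unfold dampWeight
  exact div_le_of_le_mul₀ (by positivity) (by norm_num) (by nlinarith [sq_nonneg ε, sq_nonneg ‖a‖])

lemma norm_damp_le (ε : ℝ) (a b : E) : ‖damp ε a b‖ ≤ ‖b‖ := by
  rw [damp, norm_smul, Real.norm_of_nonneg (dampWeight_nonneg ε a b), dampWeight,
    div_mul_eq_mul_div]
  refine div_le_of_le_mul₀ (by positivity) (norm_nonneg b) ?_
  nlinarith [mul_nonneg (norm_nonneg b) (sq_nonneg (‖a‖ - ‖b‖)),
    mul_nonneg (norm_nonneg b) (sq_nonneg ε)]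

lemma damp_zero_right (ε : ℝ) (a : E) : damp ε a 0 = 0 := by simp [damp, dampWeight]

lemma norm_damp_self_sub_le {ε : ℝ} (hε : 0 < ε) (c : E) : ‖damp ε c c - c‖ ≤ ε := by
  have hq : 0 < ε ^ 2 + ‖c‖ ^ 2 + ‖c‖ ^ 2 := by positivity
  have h : damp ε c c - c = (-(ε ^ 2 / (ε ^ 2 + ‖c‖ ^ 2 + ‖c‖ ^ 2))) • c := by
    have h1 : dampWeight ε c c = 1 + -(ε ^ 2 / (ε ^ 2 + ‖c‖ ^ 2 + ‖c‖ ^ 2)) := by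
      unfold dampWeight
      field_simp
      ring
    rw [damp, h1, add_smul, one_smul, add_sub_cancel_left]
  rw [h, norm_smul, norm_neg, Real.norm_of_nonneg (by positivity), div_mul_eq_mul_div,
    div_le_iff₀ hq]
  nlinarith [sq_nonneg (ε - ‖c‖), mul_pos hε hε, mul_nonneg hε.le (sq_nonneg (ε - ‖c‖)),
    mul_nonneg hε.le (sq_nonneg ‖c‖), mul_pos (mul_pos hε hε) hε]

lemma contDiff_damp {ε : ℝ} (hε : 0 < ε) : ContDiff ℝ ∞ (fun z : E × E => damp ε z.1 z.2) := by
  unfold damp dampWeight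
  refine ContDiff.smul (ContDiff.div ?_ ?_ fun z => ?_) contDiff_fst
  · exact contDiff_const.mul (contDiff_snd.norm_sq ℝ)
  · exact (contDiff_const.add (contDiff_fst.norm_sq ℝ)).add (contDiff_snd.norm_sq ℝ)
  · positivity

/-- The bound does not depend on `ε`, by homogeneity; this makes gradients of damped functions
bounded in `L²` while `ε → 0`. -/
lemma norm_fderiv_damp_le {ε : ℝ} (hε : 0 < ε) (z : E × E) :
    ‖fderiv ℝ (fun z : E × E => damp ε z.1 z.2) z‖ ≤ 7 := by
  refine ContinuousLinearMap.opNorm_le_bound _ (by norm_num) fun v => ?_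
  obtain ⟨a, b⟩ := z
  obtain ⟨α, β⟩ := v
  set q : ℝ := ε ^ 2 + ‖a‖ ^ 2 + ‖b‖ ^ 2 with hq
  have hq0 : 0 < q := by positivity
  -- The derivative is computed along the line through `(a, b)` in the direction `(α, β)`.
  have hα : HasDerivAt (fun t : ℝ => a + t • α) α 0 := by
    simpa using ((hasDerivAt_id (0 : ℝ)).smul_const α).const_add a
  have hβ : HasDerivAt (fun t : ℝ => b + t • β) β 0 := by
    simpa using ((hasDerivAt_id (0 : ℝ)).smul_const β).const_add b
  have hw : HasDerivAt (fun t : ℝ => dampWeight ε (a + t • α) (b + t • β))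
      ((2 * (2 * inner ℝ b β) * q - 2 * ‖b‖ ^ 2 * (2 * inner ℝ a α + 2 * inner ℝ b β)) / q ^ 2)
      0 := by
    have := (hβ.norm_sq.const_mul 2).fun_div ((hα.norm_sq.const_add (ε ^ 2)).add hβ.norm_sq)
      (by simpa [hq] using hq0.ne')
    simpa [dampWeight, hq] using this
  have hd : HasDerivAt (fun t : ℝ => damp ε (a + t • α) (b + t • β)) _ 0 := hw.fun_smul hα
  have hd' : HasDerivAt (fun t : ℝ => damp ε (a + t • α) (b + t • β))
      (fderiv ℝ (fun z : E × E => damp ε z.1 z.2) (a, b) (α, β)) 0 := by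
    have h := ((contDiff_damp (E := E) hε).differentiable (by simp) (a, b)).hasFDerivAt
    have h0 : ((a, b) : E × E) = (a + (0 : ℝ) • α, b + (0 : ℝ) • β) := by simp
    rw [h0] at h
    simpa [Function.comp_def] using h.comp_hasDerivAt (0 : ℝ) (hα.prodMk hβ)
  rw [hd'.unique hd]
  simp only [zero_smul, add_zero]
  have h1 : |inner ℝ a α| ≤ ‖a‖ * ‖α‖ := abs_real_inner_le_norm a α
  have h2 : |inner ℝ b β| ≤ ‖b‖ * ‖β‖ := abs_real_inner_le_norm b β
  have hAB : 2 * (‖a‖ * ‖b‖) ≤ q := by nlinarith [sq_nonneg (‖a‖ - ‖b‖), sq_nonneg ε]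
  have hB : ‖b‖ ^ 2 ≤ q := by nlinarith [sq_nonneg ‖a‖, sq_nonneg ε]
  have hX : ‖α‖ ≤ ‖((α, β) : E × E)‖ := le_max_left _ _
  have hY : ‖β‖ ≤ ‖((α, β) : E × E)‖ := le_max_right _ _
  have hnum : |2 * (2 * inner ℝ b β) * q - 2 * ‖b‖ ^ 2 * (2 * inner ℝ a α + 2 * inner ℝ b β)|
      ≤ 4 * (‖b‖ * ‖β‖) * q + 4 * ‖b‖ ^ 2 * (‖a‖ * ‖α‖ + ‖b‖ * ‖β‖) := by
    have e1 := mul_le_mul_of_nonneg_right h2 hq0.le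
    have e2 := mul_le_mul_of_nonneg_left (add_le_add h1 h2) (sq_nonneg ‖b‖)
    have e3 := mul_le_mul_of_nonneg_left (abs_add_le (inner ℝ a α) (inner ℝ b β)) (sq_nonneg ‖b‖)
    refine (abs_sub _ _).trans ?_
    have e4 : |2 * (2 * inner ℝ b β) * q| = 4 * (|inner ℝ b β| * q) := by
      rw [abs_mul, abs_mul, abs_mul, abs_of_pos hq0]; norm_num; ring
    have e5 : |2 * ‖b‖ ^ 2 * (2 * inner ℝ a α + 2 * inner ℝ b β)|
        = 4 * (‖b‖ ^ 2 * |inner ℝ a α + inner ℝ b β|) := by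
      rw [← mul_add, abs_mul, abs_mul, abs_mul]; simp; ring
    rw [e4, e5]
    linarith
  have hfirst : ‖((2 * (2 * inner ℝ b β) * q
      - 2 * ‖b‖ ^ 2 * (2 * inner ℝ a α + 2 * inner ℝ b β)) / q ^ 2) • a‖ ≤ ‖α‖ + 4 * ‖β‖ := by
    rw [norm_smul, Real.norm_eq_abs, abs_div, abs_of_pos (by positivity : 0 < q ^ 2),
      div_mul_eq_mul_div, div_le_iff₀ (by positivity)]
    refine (mul_le_mul_of_nonneg_right hnum (norm_nonneg a)).trans ?_
    have k1 : (‖a‖ * ‖b‖) * (‖a‖ * ‖b‖) ≤ q ^ 2 / 4 := by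
      nlinarith [mul_nonneg (norm_nonneg a) (norm_nonneg b)]
    have k2 : (‖a‖ * ‖b‖) * ‖b‖ ^ 2 ≤ q ^ 2 / 2 := by
      nlinarith [mul_nonneg (norm_nonneg a) (norm_nonneg b), sq_nonneg ‖b‖]
    have k3 : (‖a‖ * ‖b‖) * q ≤ q ^ 2 / 2 := by nlinarith
    nlinarith [mul_le_mul_of_nonneg_right k1 (norm_nonneg α),
      mul_le_mul_of_nonneg_right k2 (norm_nonneg β), mul_le_mul_of_nonneg_right k3 (norm_nonneg β)]
  have hsecond : ‖dampWeight ε a b • α‖ ≤ 2 * ‖α‖ := by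
    rw [norm_smul, Real.norm_of_nonneg (dampWeight_nonneg ε a b)]
    exact mul_le_mul_of_nonneg_right (dampWeight_le_two ε a b) (norm_nonneg α)
  refine (norm_add_le _ _).trans ?_
  linarith

lemma norm_damp_sub_le {ε : ℝ} (hε : 0 < ε) (a b c : E) :
    ‖damp ε a b - c‖ ≤ 7 * (‖a - c‖ + ‖b - c‖) + ε := by
  have h := (convex_univ (𝕜 := ℝ) (E := E × E)).norm_image_sub_le_of_norm_fderiv_le
    (f := fun z : E × E => damp ε z.1 z.2) (x := (c, c)) (y := (a, b)) (𝕜 := ℝ)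
    (fun z _ => (contDiff_damp hε).differentiable (by simp) z)
    (fun z _ => norm_fderiv_damp_le hε z) (mem_univ _) (mem_univ _)
  have h2 := norm_damp_self_sub_le hε c
  have h3 : ‖((a, b) : E × E) - (c, c)‖ ≤ ‖a - c‖ + ‖b - c‖ :=
    max_le_add_of_nonneg (norm_nonneg _) (norm_nonneg _)
  have h4 := norm_sub_le_norm_sub_add_norm_sub (damp ε a b) (damp ε c c) c
  simp only at h
  linarith

end

/-! ### Test functions and weak gradients -/

variable {N m : ℕ}

lemma IsTest.partialDeriv {Y : Type*} [NormedAddCommGroup Y] [NormedSpace ℝ Y] {g : Eucl N → Y}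
    (hg : IsTest g) (j : Fin N) : IsTest (pderiv j g) :=
  ⟨(hg.1.fderiv_right (m := ∞) (by simp)).clm_apply contDiff_const,
    hg.2.fderiv_apply (𝕜 := ℝ) _⟩

lemma IsTest.coord {g : Eucl N → Eucl m} (hg : IsTest g) (i : Fin m) : IsTest (fun x => g x i) :=
  ⟨contDiff_euclidean.1 hg.1 i, hg.2.comp_left (g := fun y : Eucl m => y i) rfl⟩

lemma IsTest.integrable_inner {W g : Eucl N → Eucl m} (hg : IsTest g) (hW : LocallyIntegrable W) :
    Integrable (fun x => inner ℝ (W x) (g x)) := by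
  refine ((hW.integrable_smul_left_of_hasCompactSupport hg.1.continuous.norm
    hg.2.norm).norm).mono' (hW.aestronglyMeasurable.inner hg.1.continuous.aestronglyMeasurable)
    (Eventually.of_forall fun x => ?_)
  rw [norm_smul, norm_norm, mul_comm]
  exact norm_inner_le_norm _ _

lemma IsTest.hasWeakGradient {g : Eucl N → Eucl m} (hg : IsTest g) :
    HasWeakGradient g (fun j => pderiv j g) := by
  refine ⟨hg.1.continuous.locallyIntegrable, fun j =>
    ⟨(hg.partialDeriv j).1.continuous.locallyIntegrable, fun ψ hψ => ?_⟩⟩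
  have := integral_bilinear_hasLineDerivAt_right_eq_neg_left_of_integrable (μ := volume)
    (f := g) (f' := pderiv j g) (g := ψ) (g' := pderiv j ψ)
    (B := (ContinuousLinearMap.lsmul ℝ ℝ (E := Eucl m)).flip)
    (v := EuclideanSpace.single j 1) ?_ ?_ ?_ ?_ ?_
  · simpa using this
  · exact (hψ.1.continuous.smul (hg.partialDeriv j).1.continuous).integrable_of_hasCompactSupport
      hψ.2.smul_right
  · exact ((hψ.partialDeriv j).1.continuous.smul hg.1.continuous).integrable_of_hasCompactSupport
      (hψ.partialDeriv j).2.smul_right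
  · exact (hψ.1.continuous.smul hg.1.continuous).integrable_of_hasCompactSupport
      hψ.2.smul_right
  · exact fun x _ => ((hg.1.differentiable (by simp) x).hasFDerivAt).hasLineDerivAt _
  · exact fun x _ => ((hψ.1.differentiable (by simp) x).hasFDerivAt).hasLineDerivAt _

/-- The definition of the weak gradient with vector-valued test functions, obtained coordinate by
coordinate. -/
lemma HasWeakGradient.integral_inner {W : Eucl N → Eucl m} {V : Fin N → Eucl N → Eucl m}
    (h : HasWeakGradient W V) (j : Fin N) {χ : Eucl N → Eucl m} (hχ : IsTest χ) :
    ∫ x, inner ℝ (χ x) (V j x) = - ∫ x, inner ℝ (pderiv j χ x) (W x) := by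
  have hint : ∀ {c : Eucl N → ℝ} {Z : Eucl N → Eucl m}, IsTest c → LocallyIntegrable Z →
      Integrable (fun x => c x • Z x) := fun hc hZ =>
    hZ.integrable_smul_left_of_hasCompactSupport hc.1.continuous hc.2
  have hcoord : ∀ {Z : Eucl N → Eucl m} (i : Fin m), Integrable Z →
      (∫ x, Z x) i = ∫ x, Z x i := fun {Z} i hZ =>
    ((EuclideanSpace.proj (𝕜 := ℝ) i).integral_comp_comm hZ).symm
  have hp : ∀ (i : Fin m) x, pderiv j (fun x => χ x i) x = pderiv j χ x i := fun i x => by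
    have h : HasFDerivAt (fun x => χ x i) _ x :=
      (EuclideanSpace.proj (𝕜 := ℝ) i : Eucl m →L[ℝ] ℝ).hasFDerivAt.comp x
        (hχ.1.differentiable (by simp) x).hasFDerivAt
    exact congrArg (fun A => A (EuclideanSpace.single j 1)) h.fderiv
  have hsum : ∀ {c Z : Eucl N → Eucl m}, IsTest c → LocallyIntegrable Z →
      ∫ x, inner ℝ (c x) (Z x) = ∑ i, (∫ x, c x i • Z x) i := fun {c Z} hc hZ => by
    simp_rw [hcoord _ (hint (hc.coord _) hZ)]
    rw [← integral_finsetSum _ fun i _ => ((hint (hc.coord i) hZ).eval_piLp i)]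
    refine integral_congr_ae (Eventually.of_forall fun x => ?_)
    simp [PiLp.inner_apply, mul_comm]
  rw [hsum hχ (h.2 j).1, hsum (hχ.partialDeriv j) h.1, ← Finset.sum_neg_distrib]
  refine Finset.sum_congr rfl fun i _ => ?_
  have := congrArg (fun z : Eucl m => z i) ((h.2 j).2 _ (hχ.coord i))
  simp only [hp] at this
  rw [this]; simp

/-! ### Convergence almost everywhere and weak convergence of gradients -/

/-- Convergence in `L¹_loc` gives almost everywhere convergence along a subsequence: choose the
`n`-th term within `2⁻ⁿ` of the limit in `L¹` of the ball of radius `n`, and sum. -/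
lemma exists_subseq_tendsto_ae_of_locally_L1 {f : ℕ → Eucl N → Eucl m} {W : Eucl N → Eucl m}
    (hf : ∀ n, LocallyIntegrable (f n)) (hW : LocallyIntegrable W)
    (h : ∀ K : Set (Eucl N), IsCompact K →
      Tendsto (fun n => ∫ x in K, ‖f n x - W x‖) atTop (𝓝 0)) :
    ∃ s : ℕ → ℕ, StrictMono s ∧
      ∀ᵐ x, Tendsto (fun n => f (s n) x) atTop (𝓝 (W x)) := by
  obtain ⟨s, hs, hsmall⟩ := extraction_forall_of_eventually fun n : ℕ =>
    (h (Metric.closedBall 0 n) (isCompact_closedBall 0 n)).eventually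
      (gt_mem_nhds (show (0 : ℝ) < (1 / 2) ^ n by positivity))
  refine ⟨s, hs, ?_⟩
  have hmeas : ∀ n : ℕ, AEMeasurable (fun x => (Metric.closedBall (0 : Eucl N) n).indicator
      (fun x => ‖f (s n) x - W x‖ₑ) x) := fun n =>
    ((hf _).aestronglyMeasurable.sub hW.aestronglyMeasurable).enorm.indicator
      measurableSet_closedBall
  have hfin : ∫⁻ x, ∑' n : ℕ, (Metric.closedBall (0 : Eucl N) n).indicator
      (fun x => ‖f (s n) x - W x‖ₑ) x ≠ ⊤ := by
    rw [lintegral_tsum hmeas]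
    refine ne_top_of_le_ne_top (b := ∑' n : ℕ, ENNReal.ofReal ((1 / 2) ^ n)) ?_
      (ENNReal.tsum_le_tsum fun n => ?_)
    · rw [← ENNReal.ofReal_tsum_of_nonneg (fun n => by positivity) summable_geometric_two]
      exact ENNReal.ofReal_ne_top
    · have hint : IntegrableOn (fun x => f (s n) x - W x) (Metric.closedBall 0 n) :=
        ((hf _).integrableOn_isCompact (isCompact_closedBall 0 n)).sub
          (hW.integrableOn_isCompact (isCompact_closedBall 0 n))
      rw [lintegral_indicator measurableSet_closedBall,
        ← ofReal_integral_norm_eq_lintegral_enorm hint]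
      exact ENNReal.ofReal_le_ofReal (hsmall n).le
  filter_upwards [ae_lt_top' (AEMeasurable.tsum hmeas) hfin] with x hx
  rw [tendsto_iff_edist_tendsto_0]
  refine (ENNReal.tendsto_atTop_zero_of_tsum_ne_top hx.ne).congr' ?_
  filter_upwards [eventually_ge_atTop ⌈‖x‖⌉₊] with n hn
  rw [indicator_of_mem (by simpa using Nat.ceil_le.1 hn), edist_eq_enorm_sub]

/-- A bounded sequence `x` that converges weakly to `v` against every member of a sequence `y → v`
satisfies `⟪v, x n⟫ → ‖v‖²`. -/
lemma tendsto_inner_of_bounded_of_tendsto {H : Type*} [NormedAddCommGroup H] [InnerProductSpace ℝ H]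
    {x y : ℕ → H} {v : H} {C : ℝ} (hx : ∀ᶠ n in atTop, ‖x n‖ ≤ C) (hy : Tendsto y atTop (𝓝 v))
    (h : ∀ l, Tendsto (fun n => inner ℝ (y l) (x n)) atTop (𝓝 (inner ℝ (y l) v))) :
    Tendsto (fun n => inner ℝ v (x n)) atTop (𝓝 (inner ℝ v v)) := by
  rw [Metric.tendsto_atTop']
  intro ε hε
  have hC : 0 ≤ C := by
    obtain ⟨n, hn⟩ := hx.exists
    exact (norm_nonneg _).trans hn
  have hden : 0 < C + ‖v‖ + 1 := by positivity
  obtain ⟨l, hl⟩ := ((tendsto_iff_norm_sub_tendsto_zero.1 hy).eventually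
    (gt_mem_nhds (show 0 < ε / 2 / (C + ‖v‖ + 1) by positivity))).exists
  have hl' : ‖y l - v‖ * (C + ‖v‖) ≤ ε / 2 := by
    rw [lt_div_iff₀ hden] at hl
    nlinarith [norm_nonneg (y l - v)]
  obtain ⟨n₀, hn₀⟩ := eventually_atTop.1
    (hx.and ((Metric.tendsto_nhds.1 (h l)) (ε / 2) (by positivity)))
  refine ⟨n₀, fun n hn => ?_⟩
  obtain ⟨h1, h2⟩ := hn₀ n hn.le
  rw [Real.dist_eq] at h2 ⊢
  have e : (inner ℝ v (x n) - inner ℝ v v : ℝ) = (inner ℝ (y l) (x n) - inner ℝ (y l) v)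
      - inner ℝ (y l - v) (x n) + inner ℝ (y l - v) v := by
    simp only [inner_sub_left]; ring
  have h3 := abs_real_inner_le_norm (y l - v) (x n)
  have h4 := abs_real_inner_le_norm (y l - v) v
  have h5 := mul_le_mul_of_nonneg_left h1 (norm_nonneg (y l - v))
  rw [e]
  have h6 := abs_add_le
    ((inner ℝ (y l) (x n) - inner ℝ (y l) v : ℝ) - inner ℝ (y l - v) (x n)) (inner ℝ (y l - v) v)
  have h7 := abs_sub (inner ℝ (y l) (x n) - inner ℝ (y l) v : ℝ) (inner ℝ (y l - v) (x n))
  linarith [mul_add ‖y l - v‖ C ‖v‖]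

/-- If `ψ n → W` in `L¹_loc` with gradients bounded in `L²`, then `∇ψ n` converges weakly to `V` when
tested against `V` itself. Since `V` is an `L²` limit of gradients of test functions, it suffices to
test against these, where both sides can be integrated by parts. -/
lemma tendsto_integral_inner_pderiv {W : Eucl N → Eucl m} {V : Fin N → Eucl N → Eucl m}
    (h : HasWeakGradient W V) (j : Fin N) (hV : MemLp (V j) 2)
    {φ ψ : ℕ → Eucl N → Eucl m} (hφ : ∀ n, IsTest (φ n)) (hψ : ∀ n, IsTest (ψ n))
    (hφV : Tendsto (fun n => eLpNorm (fun x => pderiv j (φ n) x - V j x) 2 volume) atTop (𝓝 0))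
    (hψW : ∀ K : Set (Eucl N), IsCompact K →
      Tendsto (fun n => ∫ x in K, ‖ψ n x - W x‖) atTop (𝓝 0))
    {C : NNReal} (hC : ∀ᶠ n in atTop, eLpNorm (pderiv j (ψ n)) 2 volume ≤ C) :
    Tendsto (fun n => ∫ x, inner ℝ (V j x) (pderiv j (ψ n) x)) atTop
      (𝓝 (∫ x, ‖V j x‖ ^ 2)) := by
  have hmem : ∀ {g : Eucl N → Eucl m}, IsTest g → MemLp (pderiv j g) 2 := fun hg =>
    (hg.partialDeriv j).1.continuous.memLp_of_hasCompactSupport (hg.partialDeriv j).2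
  have hinner : ∀ {g k : Eucl N → Eucl m} (hg : MemLp g 2) (hk : MemLp k 2),
      inner ℝ (hg.toLp g) (hk.toLp k) = ∫ x, inner ℝ (g x) (k x) := fun hg hk => by
    rw [L2.inner_def]
    refine integral_congr_ae ?_
    filter_upwards [hg.coeFn_toLp, hk.coeFn_toLp] with x h1 h2
    rw [h1, h2]
  have key := tendsto_inner_of_bounded_of_tendsto (x := fun n => (hmem (hψ n)).toLp _)
    (y := fun n => (hmem (hφ n)).toLp _) (v := hV.toLp _) (C := C) ?_ ?_ ?_
  · simp only [hinner, real_inner_self_eq_norm_sq] at key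
    exact key
  · filter_upwards [hC] with n hn
    rw [Lp.norm_toLp]
    exact ENNReal.toReal_le_coe_of_le_coe hn
  · rw [Lp.tendsto_Lp_iff_tendsto_eLpNorm'']
    exact hφV
  · intro l
    simp only [hinner]
    have hχ := (hφ l).partialDeriv j
    have hχ' := hχ.partialDeriv j
    simp only [h.integral_inner j hχ, (hψ _).hasWeakGradient.integral_inner j hχ]
    refine Tendsto.neg ?_
    obtain ⟨M, hM⟩ := hχ'.1.continuous.bounded_above_of_compact_support hχ'.2
    rw [tendsto_iff_dist_tendsto_zero]
    have hlim := (hψW _ hχ'.2).const_mul M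
    rw [mul_zero] at hlim
    refine squeeze_zero (fun _ => dist_nonneg) (fun n => ?_) hlim
    have hi : ∀ {Z : Eucl N → Eucl m}, LocallyIntegrable Z →
        Integrable fun x => inner ℝ (pderiv j (pderiv j (φ l)) x) (Z x) := fun hZ => by
      simpa only [real_inner_comm] using hχ'.integrable_inner hZ
    rw [Real.dist_eq, ← integral_sub (hi (hψ n).1.continuous.locallyIntegrable) (hi h.1),
      ← integral_const_mul, ← Real.norm_eq_abs,
      ← setIntegral_eq_integral_of_forall_compl_eq_zero
        (s := tsupport (pderiv j (pderiv j (φ l))))]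
    · refine norm_integral_le_of_norm_le ?_ (Eventually.of_forall fun x => ?_)
      · exact ((((hψ n).1.continuous.locallyIntegrable.integrableOn_isCompact hχ'.2).sub
          (h.1.integrableOn_isCompact hχ'.2)).norm).const_mul M
      · rw [← inner_sub_right]
        exact (norm_inner_le_norm _ _).trans
          (mul_le_mul_of_nonneg_right (hM x) (norm_nonneg _))
    · intro x hx
      simp [image_eq_zero_of_notMem_tsupport hx]

/-! ### Damped approximations and the energy identity -/

lemma IsTest.damp {φ χ : Eucl N → Eucl m} {ε : ℝ} (hε : 0 < ε) (hφ : IsTest φ) (hχ : IsTest χ) :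
    IsTest (fun x => damp ε (φ x) (χ x)) := by
  have hsmooth := (contDiff_damp (E := Eucl m) hε).comp (hφ.1.prodMk hχ.1)
  refine ⟨hsmooth, hχ.2.mono fun x hx => ?_⟩
  rw [Function.mem_support] at hx ⊢
  rintro h
  exact hx (by rw [h, damp_zero_right])

lemma norm_pderiv_damp_le {φ χ : Eucl N → Eucl m} {ε : ℝ} (hε : 0 < ε) (hφ : IsTest φ)
    (hχ : IsTest χ) (j : Fin N) (x : Eucl N) :
    ‖pderiv j (fun x => damp ε (φ x) (χ x)) x‖ ≤ 7 * (‖pderiv j φ x‖ + ‖pderiv j χ x‖) := by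
  have h := ((contDiff_damp (E := Eucl m) hε).differentiable (by simp)
    (φ x, χ x)).hasFDerivAt.comp x ((hφ.1.differentiable (by simp) x).hasFDerivAt.prodMk
      (hχ.1.differentiable (by simp) x).hasFDerivAt)
  have h' : pderiv j (fun x => damp ε (φ x) (χ x)) x =
      fderiv ℝ (fun z : Eucl m × Eucl m => damp ε z.1 z.2) (φ x, χ x)
        (pderiv j φ x, pderiv j χ x) :=
    congrArg (fun A => A (EuclideanSpace.single j 1)) h.fderiv
  rw [h']
  refine (ContinuousLinearMap.le_of_opNorm_le _ (norm_fderiv_damp_le hε _) _).trans ?_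
  gcongr
  exact max_le_add_of_nonneg (norm_nonneg _) (norm_nonneg _)

/-- The damped functions `damp ε (φ k) χ` stay below `|χ|`, so that `|G| |χ|` is a majorant. -/
lemma tendsto_integral_inner_damp {G W χ : Eucl N → Eucl m} {φ : ℕ → Eucl N → Eucl m} {ε : ℝ}
    (hε : 0 < ε) (hG : LocallyIntegrable G) (hφ : ∀ n, IsTest (φ n)) (hχ : IsTest χ)
    (hlim : ∀ᵐ x, Tendsto (fun n => φ n x) atTop (𝓝 (W x))) :
    Tendsto (fun k => ∫ x, inner ℝ (G x) (damp ε (φ k x) (χ x))) atTop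
      (𝓝 (∫ x, inner ℝ (G x) (damp ε (W x) (χ x)))) := by
  refine tendsto_integral_of_dominated_convergence (fun x => ‖‖χ x‖ • G x‖)
    (fun k => (((hφ k).damp hε hχ).integrable_inner hG).aestronglyMeasurable)
    (hG.integrable_smul_left_of_hasCompactSupport hχ.1.continuous.norm hχ.2.norm).norm
    (fun k => Eventually.of_forall fun x => ?_) ?_
  · rw [norm_smul, norm_norm, mul_comm]
    exact (norm_inner_le_norm _ _).trans
      (mul_le_mul_of_nonneg_left (norm_damp_le _ _ _) (norm_nonneg _))
  · filter_upwards [hlim] with x hx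
    have hd : Tendsto (fun k => damp ε (φ k x) (χ x)) atTop (𝓝 (damp ε (W x) (χ x))) := by
      have hc := (contDiff_damp (E := Eucl m) hε).continuous.tendsto (W x, χ x)
      have hp := hx.prodMk_nhds (tendsto_const_nhds (x := χ x))
      have hcomp := hc.comp hp
      exact hcomp
    exact tendsto_const_nhds.inner hd

lemma tendsto_damp {E : Type*} [NormedAddCommGroup E] [InnerProductSpace ℝ E]
    {ε : ℕ → ℝ} {b : ℕ → E} {c : E} (hε : ∀ n, 0 < ε n) (hε0 : Tendsto ε atTop (𝓝 0))
    (hb : Tendsto b atTop (𝓝 c)) : Tendsto (fun n => damp (ε n) c (b n)) atTop (𝓝 c) := by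
  rw [tendsto_iff_norm_sub_tendsto_zero] at hb ⊢
  refine squeeze_zero (fun _ => norm_nonneg _) (fun n => norm_damp_sub_le (hε n) c (b n) c) ?_
  simpa using (hb.const_mul 7).add hε0

/-- Damping multiplies `W` by a factor in `[0, 2]`, so that `2 |G · W|` is a majorant. This is where the
integrability of `G · W` enters. -/
lemma tendsto_integral_inner_damp_diag {G W : Eucl N → Eucl m} {φ : ℕ → Eucl N → Eucl m}
    {ε : ℕ → ℝ} (hε : ∀ n, 0 < ε n) (hε0 : Tendsto ε atTop (𝓝 0))
    (hG : LocallyIntegrable G) (hW : LocallyIntegrable W) (hφ : ∀ n, IsTest (φ n))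
    (hlim : ∀ᵐ x, Tendsto (fun n => φ n x) atTop (𝓝 (W x)))
    (hGW : Integrable fun x => inner ℝ (G x) (W x)) :
    Tendsto (fun n => ∫ x, inner ℝ (G x) (damp (ε n) (W x) (φ n x))) atTop
      (𝓝 (∫ x, inner ℝ (G x) (W x))) := by
  refine tendsto_integral_of_dominated_convergence (fun x => 2 * ‖inner ℝ (G x) (W x)‖)
    (fun n => ?_) (hGW.norm.const_mul 2) (fun n => Eventually.of_forall fun x => ?_) ?_
  · have hc := (contDiff_damp (E := Eucl m) (hε n)).continuous.comp_aestronglyMeasurable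
      (hW.aestronglyMeasurable.prodMk (hφ n).1.continuous.aestronglyMeasurable)
    exact hG.aestronglyMeasurable.inner hc
  · rw [damp, inner_smul_right, norm_mul, Real.norm_of_nonneg (dampWeight_nonneg _ _ _)]
    exact mul_le_mul_of_nonneg_right (dampWeight_le_two _ _ _) (norm_nonneg _)
  · filter_upwards [hlim] with x hx
    exact tendsto_const_nhds.inner (tendsto_damp hε hε0 hx)

lemma tendsto_damp_locally_L1 {W : Eucl N → Eucl m} {φ χ : ℕ → Eucl N → Eucl m}
    {ε : ℕ → ℝ} (hε : ∀ n, 0 < ε n) (hε0 : Tendsto ε atTop (𝓝 0)) (hW : LocallyIntegrable W)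
    (hφ : ∀ n, IsTest (φ n)) (hχ : ∀ n, IsTest (χ n)) {K : Set (Eucl N)} (hK : IsCompact K)
    (hφW : Tendsto (fun n => ∫ x in K, ‖φ n x - W x‖) atTop (𝓝 0))
    (hχW : Tendsto (fun n => ∫ x in K, ‖χ n x - W x‖) atTop (𝓝 0)) :
    Tendsto (fun n => ∫ x in K, ‖damp (ε n) (φ n x) (χ n x) - W x‖) atTop (𝓝 0) := by
  have hi : ∀ {g : Eucl N → Eucl m}, IsTest g → IntegrableOn (fun x => ‖g x - W x‖) K :=
    fun hg => ((hg.1.continuous.locallyIntegrable.integrableOn_isCompact hK).sub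
      (hW.integrableOn_isCompact hK)).norm
  have hlim := ((hφW.add hχW).const_mul 7).add (hε0.const_mul (volume.real K))
  simp only [add_zero, mul_zero] at hlim
  refine squeeze_zero (fun n => integral_nonneg fun _ => norm_nonneg _) (fun n => ?_) hlim
  have hconst : IntegrableOn (fun _ : Eucl N => ε n) K := integrableOn_const hK.measure_lt_top.ne
  have hsum : IntegrableOn (fun x => 7 * (‖φ n x - W x‖ + ‖χ n x - W x‖)) K :=
    ((hi (hφ n)).add (hi (hχ n))).const_mul 7
  calc ∫ x in K, ‖damp (ε n) (φ n x) (χ n x) - W x‖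
      ≤ ∫ x in K, (7 * (‖φ n x - W x‖ + ‖χ n x - W x‖) + ε n) :=
        integral_mono (hi ((hφ n).damp (hε n) (hχ n))) (hsum.add hconst)
          fun x => norm_damp_sub_le (hε n) _ _ _
    _ = _ := by
        rw [integral_add hsum hconst, integral_const_mul]
        congr 1
        · rw [← integral_add (hi (hφ n)) (hi (hχ n))]
        · simp

lemma exists_eventually_eLpNorm_le {α E : Type*} [MeasurableSpace α] {μ : Measure α}
    [NormedAddCommGroup E] {g : ℕ → α → E} {v : α → E}
    (hg : ∀ n, AEStronglyMeasurable (g n) μ) (hv : MemLp v 2 μ)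
    (h : Tendsto (fun n => eLpNorm (fun x => g n x - v x) 2 μ) atTop (𝓝 0)) :
    ∃ B : NNReal, ∀ᶠ n in atTop, eLpNorm (g n) 2 μ ≤ B := by
  refine ⟨(1 + eLpNorm v 2 μ).toNNReal, ?_⟩
  filter_upwards [h.eventually (gt_mem_nhds one_pos)] with n hn
  rw [ENNReal.coe_toNNReal (ENNReal.add_ne_top.2 ⟨ENNReal.one_ne_top, hv.eLpNorm_ne_top⟩)]
  calc eLpNorm (g n) 2 μ = eLpNorm ((fun x => g n x - v x) + v) 2 μ := by
        congr 1; ext x; simp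
    _ ≤ eLpNorm (fun x => g n x - v x) 2 μ + eLpNorm v 2 μ :=
        eLpNorm_add_le ((hg n).sub hv.1) hv.1 (by norm_num)
    _ ≤ 1 + eLpNorm v 2 μ := by gcongr

/-- The energy identity: a finite-energy weak solution `W` of `-ΔW + G = 0` may be used as its own
test function as soon as `G · W` is integrable. -/
theorem SolvesPoisson.integral_inner_eq_neg_energy {G W : Eucl N → Eucl m}
    {V : Fin N → Eucl N → Eucl m} (h : SolvesPoisson G W V)
    (hGW : Integrable fun x => inner ℝ (G x) (W x)) :
    ∫ x, inner ℝ (G x) (W x) = - ∫ x, ∑ j, ‖V j x‖ ^ 2 := by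
  obtain ⟨φ₀, hφ₀, hφ₀W, hφ₀V⟩ := h.energy.approx
  have hW := h.energy.weakGradient.1
  obtain ⟨s, hs, hlim⟩ := exists_subseq_tendsto_ae_of_locally_L1
    (fun n => (hφ₀ n).1.continuous.locallyIntegrable) hW hφ₀W
  set φ : ℕ → Eucl N → Eucl m := fun n => φ₀ (s n)
  have hφ : ∀ n, IsTest (φ n) := fun n => hφ₀ (s n)
  have hφW := fun K hK => (hφ₀W K hK).comp hs.tendsto_atTop
  have hφV := fun j => (hφ₀V j).comp hs.tendsto_atTop
  set ε : ℕ → ℝ := fun n => 1 / ((n : ℝ) + 1)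
  have hε : ∀ n, 0 < ε n := fun n => Nat.one_div_pos_of_nat
  have hε0 : Tendsto ε atTop (𝓝 0) := tendsto_one_div_add_atTop_nhds_zero_nat
  have hex : ∀ n, ∃ k, n ≤ k ∧ dist (∫ x, inner ℝ (G x) (damp (ε n) (φ k x) (φ n x)))
      (∫ x, inner ℝ (G x) (damp (ε n) (W x) (φ n x))) < ε n := fun n =>
    ((eventually_ge_atTop n).and (Metric.tendsto_nhds.1
      (tendsto_integral_inner_damp (hε n) h.locallyIntegrable hφ (hφ n) hlim) _ (hε n))).exists
  -- For each `n`, the first limit is nearly attained at some index `k n ≥ n`.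
  choose k hnk hk using hex
  have hktop : Tendsto k atTop atTop := tendsto_atTop_mono hnk tendsto_id
  set ψ : ℕ → Eucl N → Eucl m := fun n x => damp (ε n) (φ (k n) x) (φ n x)
  have hψ : ∀ n, IsTest (ψ n) := fun n => (hφ _).damp (hε n) (hφ n)
  have hsource : Tendsto (fun n => ∫ x, inner ℝ (G x) (ψ n x)) atTop
      (𝓝 (∫ x, inner ℝ (G x) (W x))) := by
    refine (tendsto_iff_of_dist (squeeze_zero (fun _ => dist_nonneg)
      (fun n => (hk n).le) hε0)).2 ?_
    exact tendsto_integral_inner_damp_diag hε hε0 h.locallyIntegrable hW hφ hlim hGW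
  have hψW : ∀ K : Set (Eucl N), IsCompact K →
      Tendsto (fun n => ∫ x in K, ‖ψ n x - W x‖) atTop (𝓝 0) := fun K hK =>
    tendsto_damp_locally_L1 hε hε0 hW (fun n => hφ (k n)) hφ hK
      ((hφW K hK).comp hktop) (hφW K hK)
  have hmeas : ∀ j n, AEStronglyMeasurable (pderiv j (φ n)) volume := fun j n =>
    ((hφ n).partialDeriv j).1.continuous.aestronglyMeasurable
  have hgrad : ∀ j, Tendsto (fun n => ∫ x, inner ℝ (V j x) (pderiv j (ψ n) x)) atTop
      (𝓝 (∫ x, ‖V j x‖ ^ 2)) := fun j => by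
    obtain ⟨B, hB⟩ := exists_eventually_eLpNorm_le (hmeas j) (h.energy.memLp j) (hφV j)
    refine tendsto_integral_inner_pderiv h.energy.weakGradient j (h.energy.memLp j) hφ hψ
      (hφV j) hψW (C := 7 * (B + B)) ?_
    filter_upwards [hB, hktop.eventually hB] with n h1 h2
    calc eLpNorm (pderiv j (ψ n)) 2 volume
        ≤ ENNReal.ofReal 7 *
            eLpNorm ((fun x => ‖pderiv j (φ (k n)) x‖) + fun x => ‖pderiv j (φ n) x‖) 2 volume := by
          refine eLpNorm_le_mul_eLpNorm_of_ae_le_mul (Eventually.of_forall fun x => ?_) 2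
          refine (norm_pderiv_damp_le (hε n) (hφ _) (hφ n) j x).trans_eq ?_
          rw [Pi.add_apply, Real.norm_of_nonneg (by positivity)]
      _ ≤ ENNReal.ofReal 7 * (B + B) := by
          gcongr
          refine (eLpNorm_add_le (hmeas j _).norm (hmeas j _).norm (by norm_num)).trans ?_
          rw [eLpNorm_norm, eLpNorm_norm]
          exact add_le_add h2 h1
      _ = ((7 * (B + B) : NNReal) : ENNReal) := by push_cast; simp
  have hpair : ∀ j n, Integrable fun x => inner ℝ (V j x) (pderiv j (ψ n) x) := fun j n =>
    ((hψ n).partialDeriv j).integrable_inner (h.energy.weakGradient.2 j).1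
  have hsq : ∀ j, Integrable fun x => ‖V j x‖ ^ 2 := fun j =>
    (h.energy.memLp j).integrable_norm_pow (by norm_num)
  have hweak : ∀ n, ∫ x, inner ℝ (G x) (ψ n x)
      = - ∑ j, ∫ x, inner ℝ (V j x) (pderiv j (ψ n) x) := fun n => by
    have := h.weak (ψ n) (hψ n)
    rw [integral_finsetSum _ fun j _ => hpair j n] at this
    linarith
  rw [integral_finsetSum _ fun j _ => hsq j]
  refine tendsto_nhds_unique hsource ?_
  simp only [hweak]
  exact (tendsto_finsetSum _ fun j _ => hgrad j).neg

end FeedbackControl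

theorem mainTheorem7 {N m : ℕ} (T : ℝ) (hT : 0 < T)
    (F : FeedbackControl.Eucl N → FeedbackControl.Eucl m → ℝ)
    (f : FeedbackControl.Eucl N → FeedbackControl.Eucl m → FeedbackControl.Eucl N)
    (hF : ContDiff ℝ 1 (fun z : FeedbackControl.Eucl N × FeedbackControl.Eucl m => F z.1 z.2))
    (hf : ContDiff ℝ 1 (fun z : FeedbackControl.Eucl N × FeedbackControl.Eucl m => f z.1 z.2))
    (u : ℝ → FeedbackControl.Eucl N → FeedbackControl.Eucl m)
    (hu : FeedbackControl.IsFeasible T u)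
    (p : ℝ → FeedbackControl.Eucl N → FeedbackControl.Eucl N)
    (hp : FeedbackControl.IsCostate T F f u p)
    (U : ℝ → FeedbackControl.Eucl N → FeedbackControl.Eucl m)
    (gradU : ℝ → Fin N → FeedbackControl.Eucl N → FeedbackControl.Eucl m) :
    ∀ t ∈ Set.Icc (0 : ℝ) T,
      FeedbackControl.SolvesPoisson (FeedbackControl.gradI F f u p t) (U t) (gradU t) →
      MeasureTheory.Integrable
        (fun x => inner ℝ (FeedbackControl.gradI F f u p t x) (U t x)) →
      (∫ x, inner ℝ (FeedbackControl.gradI F f u p t x) (U t x))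
          = - (∫ x, ∑ j, ‖gradU t j x‖ ^ 2) ∧
        - (∫ x, ∑ j, ‖gradU t j x‖ ^ 2) ≤ 0 := by
  intro t _ hU hint
  refine ⟨hU.integral_inner_eq_neg_energy hint, neg_nonpos.2 ?_⟩
  exact integral_nonneg fun x => Finset.sum_nonneg fun j _ => sq_nonneg _
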